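/- Let $A,B\in\mathbb R^{n\times n}$ be symmetric, $a,b\in\mathbb R^n$, $c,d\in\mathbb R$, and put $f(x)=x^TAx+2a^Tx+c$, $h(x)=x^TBx+2b^Tx+d$. Assume that $h$ takes both positive and negative values, that $B\neq0$, and that $v:=\inf\{f(x): x\in\mathbb R^n,\ h(x)=0\}>-\infty$. Consider the dual semidefinite program $$\sup_{s,\mu\in\mathbb R}\left\{s:\ \begin{bmatrix}A+\mu B & a+\mu b\\ a^T+\mu b^T & c+\mu d-s\end{bmatrix}\succeq0\right\}.$$ Then the dual program has an optimal solution $(s^*,\mu^*)$. Moreover, the infimum $v$ is not attained if and only if there is exactly one $\mu^*\in\mathbb R$ that is dual feasible (i.e. such that $(s,\mu^*)$ is feasible for some $s$), and for this $\mu^*$, writing $y_0=-(A+\mu^*B)^+(a+\mu^*b)$, and letting $V$ be any matrix whose columns form a basis of the null space $\mathcal N(A+\mu^*B)$, one has $V^T(By_0+b)\in\mathcal R(V^TBV)$ and either $$V^TBV\succeq0,\qquad h(y_0)-(By_0+b)^TV(V^TBV)^+V^T(By_0+b)>0,$$ or $$V^TBV\preceq0,\qquad h(y_0)-(By_0+b)^TV(V^TBV)^+V^T(By_0+b)<0.$$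 Here $M^+$ denotes the Moore–Penrose inverse and $\mathcal R(M)$ the range of $M$. -/

import Mathlib

open Matrix

namespace QuadEq

/-- `X` is a Moore–Penrose generalized inverse of the real matrix `M` (the four Penrose equations). -/
structure IsMoorePenrose {p q : ℕ} (M : Matrix (Fin p) (Fin q) ℝ)
    (X : Matrix (Fin q) (Fin p) ℝ) : Prop where
  mul_mul_left : M * X * M = M
  mul_mul_right : X * M * X = X
  symm_left : (M * X)ᵀ = M * X
  symm_right : (X * M)ᵀ = X * M

theorem IsMoorePenrose.unique {p q : ℕ} {M : Matrix (Fin p) (Fin q) ℝ}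
    {X Y : Matrix (Fin q) (Fin p) ℝ} (hX : IsMoorePenrose M X) (hY : IsMoorePenrose M Y) :
    X = Y := by
  have h1 : M * X = M * Y := by
    calc M * X = (M * X)ᵀ := hX.symm_left.symm
      _ = (M * Y * (M * X))ᵀ := by rw [← Matrix.mul_assoc, hY.mul_mul_left]
      _ = (M * X) * (M * Y) := by rw [transpose_mul, hX.symm_left, hY.symm_left]
      _ = M * Y := by rw [← Matrix.mul_assoc, hX.mul_mul_left]
  have h2 : X * M = Y * M := by
    calc X * M = (X * M)ᵀ := hX.symm_right.symm
      _ = (X * M * (Y * M))ᵀ := by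
        rw [Matrix.mul_assoc X M, ← Matrix.mul_assoc M Y M, hY.mul_mul_left]
      _ = (Y * M) * (X * M) := by rw [transpose_mul, hX.symm_right, hY.symm_right]
      _ = Y * M := by rw [Matrix.mul_assoc Y M, ← Matrix.mul_assoc M X M, hX.mul_mul_left]
  calc X = X * M * X := hX.mul_mul_right.symm
    _ = Y * (M * X) := by rw [h2, Matrix.mul_assoc]
    _ = Y := by rw [h1, ← Matrix.mul_assoc, hY.mul_mul_right]

theorem exists_isMoorePenrose_of_symm {q : ℕ} (G : Matrix (Fin q) (Fin q) ℝ) (hG : G.IsHermitian) :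
    ∃ P : Matrix (Fin q) (Fin q) ℝ, IsMoorePenrose G P ∧ Pᵀ = P := by
  obtain ⟨U, d, hU, hGd⟩ : ∃ (U : Matrix (Fin q) (Fin q) ℝ) (d : Fin q → ℝ),
      Uᵀ * U = 1 ∧ G = U * diagonal d * Uᵀ := by
    refine ⟨hG.eigenvectorUnitary, hG.eigenvalues, ?_, ?_⟩
    · have := Unitary.coe_star_mul_self hG.eigenvectorUnitary
      rwa [star_eq_conjTranspose, conjTranspose_eq_transpose_of_trivial] at this
    · have := hG.spectral_theorem
      rw [Unitary.conjStarAlgAut_apply, star_eq_conjTranspose,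
        conjTranspose_eq_transpose_of_trivial] at this
      exact this
  have key : ∀ e f : Fin q → ℝ, U * diagonal e * Uᵀ * (U * diagonal f * Uᵀ)
      = U * diagonal (fun i => e i * f i) * Uᵀ := by
    intro e f
    calc U * diagonal e * Uᵀ * (U * diagonal f * Uᵀ)
        = U * diagonal e * (Uᵀ * U) * diagonal f * Uᵀ := by simp only [Matrix.mul_assoc]
      _ = U * diagonal (fun i => e i * f i) * Uᵀ := by
        rw [hU, Matrix.mul_one, Matrix.mul_assoc U, diagonal_mul_diagonal]
  have symm : ∀ e : Fin q → ℝ, (U * diagonal e * Uᵀ)ᵀ = U * diagonal e * Uᵀ := by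
    intro e
    simp [transpose_mul, Matrix.mul_assoc]
  have h3 : ∀ t : ℝ, t * t⁻¹ * t = t := fun t => by
    rcases eq_or_ne t 0 with rfl | ht
    · simp
    · field_simp
  have h4 : ∀ t : ℝ, t⁻¹ * t * t⁻¹ = t⁻¹ := fun t => by
    rcases eq_or_ne t 0 with rfl | ht
    · simp
    · field_simp
  refine ⟨U * diagonal (fun i => (d i)⁻¹) * Uᵀ, ⟨?_, ?_, ?_, ?_⟩, symm _⟩
  · rw [hGd, key, key]
    simp only [h3]
  · rw [hGd, key, key]
    simp only [h4]
  · rw [hGd, key, symm]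
  · rw [hGd, key, symm]

theorem exists_isMoorePenrose {p q : ℕ} (M : Matrix (Fin p) (Fin q) ℝ) :
    ∃ X : Matrix (Fin q) (Fin p) ℝ, IsMoorePenrose M X := by
  have hG : (Mᵀ * M).IsHermitian := by
    rw [Matrix.IsHermitian, conjTranspose_eq_transpose_of_trivial]
    simp
  obtain ⟨P, hP, hPs⟩ := exists_isMoorePenrose_of_symm (Mᵀ * M) hG
  have hzero : (M * P * (Mᵀ * M) - M)ᵀ * (M * P * (Mᵀ * M) - M) = 0 := by
    have h : (M * P * (Mᵀ * M) - M)ᵀ * (M * P * (Mᵀ * M) - M)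
        = (Mᵀ * M) * P * (Mᵀ * M * P * (Mᵀ * M) - Mᵀ * M)
          - (Mᵀ * M * P * (Mᵀ * M) - Mᵀ * M) := by
      simp only [transpose_sub, transpose_mul, transpose_transpose, hPs, Matrix.mul_sub,
        Matrix.sub_mul, Matrix.mul_assoc]
    rw [h, hP.mul_mul_left]
    simp
  have hM : M * P * (Mᵀ * M) = M := by
    rw [← conjTranspose_eq_transpose_of_trivial (M * P * (Mᵀ * M) - M),
      conjTranspose_mul_self_eq_zero] at hzero
    exact sub_eq_zero.mp hzero
  refine ⟨P * Mᵀ, ⟨?_, ?_, ?_, ?_⟩⟩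
  · simpa only [Matrix.mul_assoc] using hM
  · have := congrArg (fun Z => Z * Mᵀ) hP.mul_mul_right
    simpa only [Matrix.mul_assoc] using this
  · simp [transpose_mul, hPs, Matrix.mul_assoc]
  · have := hP.symm_right
    simpa only [Matrix.mul_assoc] using this

/-- The Moore–Penrose generalized inverse `M⁺`. -/
noncomputable def pinv {p q : ℕ} (M : Matrix (Fin p) (Fin q) ℝ) : Matrix (Fin q) (Fin p) ℝ :=
  (exists_isMoorePenrose M).choose

theorem pinv_spec {p q : ℕ} (M : Matrix (Fin p) (Fin q) ℝ) : IsMoorePenrose M (pinv M) :=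
  (exists_isMoorePenrose M).choose_spec

/-- The quadratic function `x ↦ xᵀ A x + 2 aᵀ x + c`. -/
def quad {n : ℕ} (A : Matrix (Fin n) (Fin n) ℝ) (a : Fin n → ℝ) (c : ℝ) (x : Fin n → ℝ) : ℝ :=
  x ⬝ᵥ (A *ᵥ x) + 2 * (a ⬝ᵥ x) + c

/-- The optimal value `inf {f x : h x = 0}` in the extended reals. -/
noncomputable def primalValue {n : ℕ} (f h : (Fin n → ℝ) → ℝ) : EReal :=
  ⨅ x : {x : Fin n → ℝ // h x = 0}, (f x.1 : EReal)

/-- The infimum `inf {f x : h x = 0}` is attained at a feasible point. -/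
def PrimalAttained {n : ℕ} (f h : (Fin n → ℝ) → ℝ) : Prop :=
  ∃ x : Fin n → ℝ, h x = 0 ∧ (f x : EReal) = primalValue f h

/-- Feasibility of `(s, μ)` in the dual semidefinite program: the block matrix
`[A + μ B, a + μ b; (a + μ b)ᵀ, c + μ d - s]` is positive semidefinite. -/
def DualFeasible {n : ℕ} (A : Matrix (Fin n) (Fin n) ℝ) (a : Fin n → ℝ) (c : ℝ)
    (B : Matrix (Fin n) (Fin n) ℝ) (b : Fin n → ℝ) (d : ℝ) (s μ : ℝ) : Prop :=
  (fromBlocks (A + μ • B) (replicateCol Unit (a + μ • b))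
    (replicateRow Unit (a + μ • b)) (of fun _ _ : Unit => c + μ * d - s)).PosSemidef

/-- `(s, μ)` is an optimal solution of the dual program `sup {s : (s, μ) feasible}`. -/
def DualOptimal {n : ℕ} (A : Matrix (Fin n) (Fin n) ℝ) (a : Fin n → ℝ) (c : ℝ)
    (B : Matrix (Fin n) (Fin n) ℝ) (b : Fin n → ℝ) (d : ℝ) (s μ : ℝ) : Prop :=
  DualFeasible A a c B b d s μ ∧ ∀ s' μ' : ℝ, DualFeasible A a c B b d s' μ' → s' ≤ s

/-- The columns of `V` form a basis of the null space of `M`. -/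
def IsNullBasis {n r : ℕ} (M : Matrix (Fin n) (Fin n) ℝ) (V : Matrix (Fin n) (Fin r) ℝ) : Prop :=
  LinearIndependent ℝ V.col ∧ Submodule.span ℝ (Set.range V.col) = LinearMap.ker M.mulVecLin

/-- The point `y₀ = -(A + μ B)⁺ (a + μ b)`. -/
noncomputable def basePoint {n : ℕ} (A : Matrix (Fin n) (Fin n) ℝ) (a : Fin n → ℝ)
    (B : Matrix (Fin n) (Fin n) ℝ) (b : Fin n → ℝ) (μ : ℝ) : Fin n → ℝ :=
  -(pinv (A + μ • B) *ᵥ (a + μ • b))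

/-- `h(y₀) - (B y₀ + b)ᵀ V (Vᵀ B V)⁺ Vᵀ (B y₀ + b)` for `h x = xᵀ B x + 2 bᵀ x + d`. -/
noncomputable def reducedValue {n r : ℕ} (B : Matrix (Fin n) (Fin n) ℝ) (b : Fin n → ℝ) (d : ℝ)
    (V : Matrix (Fin n) (Fin r) ℝ) (y₀ : Fin n → ℝ) : ℝ :=
  quad B b d y₀ -
    (Vᵀ *ᵥ (B *ᵥ y₀ + b)) ⬝ᵥ (pinv (Vᵀ * B * V) *ᵥ (Vᵀ *ᵥ (B *ᵥ y₀ + b)))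

end QuadEq

/-! Strong duality comes from the S-lemma with equality (`exists_multiplier`) applied to `f - v`:
some `μ₀` satisfies `f + μ₀ h ≥ v` on the whole space. By `dualFeasible_iff` this is dual
feasibility of `(v, μ₀)`, and weak duality makes it optimal. The S-lemma is proved by homogenizing;
the delicate points are those at infinity, where nonnegativity is recovered by a limit.

If two multipliers are feasible, `f + μ h` at their midpoint is coercive modulo directions along
which `f` and `h` are constant, so `v` is attained. Hence nonattainment forces uniqueness.

For a multiplier certifying `v`, the minimizers of `f + μ h` form `y₀ + ker (A + μ B)`, and the
primal solutions are the zeros of `h` there. Nonattainment thus says that the quadratic `w ↦ h (y₀ +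
V w)` has no zero; by connectedness it has constant sign, which `quad_ne_zero_iff` expresses by the
stated conditions. -/

namespace QuadEq

/-! ### Quadratic forms and the homogeneous S-lemma. -/

section Forms

variable {ι : Type*} [Fintype ι]

theorem dotProduct_mulVec_swap {M : Matrix ι ι ℝ} (hM : M.IsSymm) (x y : ι → ℝ) :
    x ⬝ᵥ (M *ᵥ y) = y ⬝ᵥ (M *ᵥ x) := by
  rw [dotProduct_mulVec, ← mulVec_transpose, hM.eq, dotProduct_comm]

theorem form_add_smul {M : Matrix ι ι ℝ} (hM : M.IsSymm) (x y : ι → ℝ) (t : ℝ) :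
    (x + t • y) ⬝ᵥ (M *ᵥ (x + t • y)) =
      x ⬝ᵥ (M *ᵥ x) + 2 * t * (x ⬝ᵥ (M *ᵥ y)) + t ^ 2 * (y ⬝ᵥ (M *ᵥ y)) := by
  have h := dotProduct_mulVec_swap hM y x
  simp only [mulVec_add, mulVec_smul, add_dotProduct, dotProduct_add, smul_dotProduct,
    dotProduct_smul, smul_eq_mul, h]
  ring

theorem posSemidef_iff_form {M : Matrix ι ι ℝ} (hM : M.IsSymm) :
    M.PosSemidef ↔ ∀ x : ι → ℝ, 0 ≤ x ⬝ᵥ (M *ᵥ x) := by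
  rw [posSemidef_iff_dotProduct_mulVec]
  simp only [star_trivial, and_iff_right_iff_imp]
  intro _
  rw [IsHermitian, conjTranspose_eq_transpose_of_trivial, hM.eq]

theorem posSemidef_mulVec_eq_zero {M : Matrix ι ι ℝ} (hM : M.IsSymm)
    (hpos : ∀ x : ι → ℝ, 0 ≤ x ⬝ᵥ (M *ᵥ x)) {x : ι → ℝ} (hx : x ⬝ᵥ (M *ᵥ x) = 0) :
    M *ᵥ x = 0 := by
  classical
  have h := (((posSemidef_iff_form hM).2 hpos).dotProduct_mulVec_zero_iff x)
  simp only [star_trivial] at h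
  exact h.1 hx

/-- The two-point inequality behind the S-lemma with equality. -/
theorem form_ratio_le {M N : Matrix ι ι ℝ} (hM : M.IsSymm) (hN : N.IsSymm)
    (h : ∀ x : ι → ℝ, x ⬝ᵥ (N *ᵥ x) = 0 → 0 ≤ x ⬝ᵥ (M *ᵥ x)) {p q : ι → ℝ}
    (hp : 0 < p ⬝ᵥ (N *ᵥ p)) (hq : q ⬝ᵥ (N *ᵥ q) < 0) :
    -(p ⬝ᵥ (M *ᵥ p)) / (p ⬝ᵥ (N *ᵥ p)) ≤ -(q ⬝ᵥ (M *ᵥ q)) / (q ⬝ᵥ (N *ᵥ q)) := by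
  set P := p ⬝ᵥ (N *ᵥ p)
  set Q := q ⬝ᵥ (N *ᵥ q)
  set R := p ⬝ᵥ (N *ᵥ q)
  set S := Real.sqrt (R ^ 2 - P * Q) with hS
  have hdisc : 0 < R ^ 2 - P * Q := by nlinarith [sq_nonneg R, mul_pos hp (neg_pos.2 hq)]
  have hSpos : 0 < S := Real.sqrt_pos.2 hdisc
  have hSS : S ^ 2 = R ^ 2 - P * Q := Real.sq_sqrt hdisc.le
  have hRS : |R| < S := abs_lt_of_sq_lt_sq (by nlinarith [mul_pos hp (neg_pos.2 hq)]) hSpos.le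
  obtain ⟨hR1, hR2⟩ := abs_lt.1 hRS
  have key : ∀ t : ℝ, P + 2 * t * R + t ^ 2 * Q = 0 →
      0 ≤ p ⬝ᵥ (M *ᵥ p) + 2 * t * (p ⬝ᵥ (M *ᵥ q)) + t ^ 2 * (q ⬝ᵥ (M *ᵥ q)) := by
    intro t ht
    rw [← form_add_smul hM]
    apply h
    rw [form_add_smul hN]
    exact ht
  have hQ0 : Q ≠ 0 := hq.ne
  -- The line `p + t q` meets the null cone of `N` at `t = (-R ± S) / Q`.
  have root : ∀ e : ℝ, e ^ 2 = S ^ 2 → P + 2 * ((-R + e) / Q) * R + ((-R + e) / Q) ^ 2 * Q = 0 := by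
    intro e he
    field_simp
    nlinarith
  have h1 := key _ (root S rfl)
  have h2 := key _ (root (-S) (by ring))
  set F := p ⬝ᵥ (M *ᵥ p)
  set G := q ⬝ᵥ (M *ᵥ q)
  set K := p ⬝ᵥ (M *ᵥ q)
  -- The weights `R + S` and `S - R` are positive because `|R| < S`, and they cancel the cross term
  -- `K`.
  have h3 : 0 ≤ (R + S) * (F + 2 * ((-R + S) / Q) * K + ((-R + S) / Q) ^ 2 * G) +
      (S - R) * (F + 2 * ((-R + -S) / Q) * K + ((-R + -S) / Q) ^ 2 * G) :=
    add_nonneg (mul_nonneg (by linarith) h1) (mul_nonneg (by linarith) h2)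
  have h4 : (R + S) * (F + 2 * ((-R + S) / Q) * K + ((-R + S) / Q) ^ 2 * G) +
      (S - R) * (F + 2 * ((-R + -S) / Q) * K + ((-R + -S) / Q) ^ 2 * G) =
      2 * S * (F - P / Q * G) := by
    have : (R + S) * (F + 2 * ((-R + S) / Q) * K + ((-R + S) / Q) ^ 2 * G) +
      (S - R) * (F + 2 * ((-R + -S) / Q) * K + ((-R + -S) / Q) ^ 2 * G) =
      2 * S * (F + (S ^ 2 - R ^ 2) / Q ^ 2 * G) := by ring
    rw [this, hSS]
    field_simp
    ring
  rw [h4] at h3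
  have h5 : 0 ≤ F - P / Q * G := by
    by_contra hneg
    nlinarith [mul_pos hSpos (neg_pos.2 (not_le.1 hneg))]
  rw [div_le_iff₀ hp]
  have : -G / Q * P = -(P / Q * G) := by ring
  linarith

/-- The homogeneous S-lemma with equality. -/
theorem exists_multiplier_form {M N : Matrix ι ι ℝ} (hM : M.IsSymm) (hN : N.IsSymm)
    (hpos : ∃ p : ι → ℝ, 0 < p ⬝ᵥ (N *ᵥ p)) (hneg : ∃ q : ι → ℝ, q ⬝ᵥ (N *ᵥ q) < 0)
    (h : ∀ x : ι → ℝ, x ⬝ᵥ (N *ᵥ x) = 0 → 0 ≤ x ⬝ᵥ (M *ᵥ x)) :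
    ∃ μ : ℝ, ∀ x : ι → ℝ, 0 ≤ x ⬝ᵥ (M *ᵥ x) + μ * (x ⬝ᵥ (N *ᵥ x)) := by
  -- Vectors with `N`-form positive bound `μ` from below, those with it negative from above; the
  -- supremum of the lower bounds fits between.
  set S : Set ℝ := (fun p : ι → ℝ => -(p ⬝ᵥ (M *ᵥ p)) / (p ⬝ᵥ (N *ᵥ p))) ''
    {p | 0 < p ⬝ᵥ (N *ᵥ p)} with hS
  obtain ⟨p₀, hp₀⟩ := hpos
  obtain ⟨q₀, hq₀⟩ := hneg
  have hub : ∀ q : ι → ℝ, q ⬝ᵥ (N *ᵥ q) < 0 →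
      -(q ⬝ᵥ (M *ᵥ q)) / (q ⬝ᵥ (N *ᵥ q)) ∈ upperBounds S := by
    rintro q hq _ ⟨p, hp, rfl⟩
    exact form_ratio_le hM hN h hp hq
  refine ⟨sSup S, fun x => ?_⟩
  rcases lt_trichotomy (x ⬝ᵥ (N *ᵥ x)) 0 with hx | hx | hx
  · have h1 : sSup S ≤ _ := csSup_le ⟨_, p₀, hp₀, rfl⟩ (hub x hx)
    rw [le_div_iff_of_neg hx] at h1
    linarith
  · rw [hx]
    simpa using h x hx
  · have h1 := le_csSup ⟨_, hub q₀ hq₀⟩ (Set.mem_image_of_mem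
      (fun p : ι → ℝ => -(p ⬝ᵥ (M *ᵥ p)) / (p ⬝ᵥ (N *ᵥ p))) hx)
    rw [div_le_iff₀ hx] at h1
    linarith

end Forms

/-! ### Homogenization and expansion of quadratic functions. -/

theorem form_fromBlocks {n : ℕ} (M : Matrix (Fin n) (Fin n) ℝ) (m : Fin n → ℝ) (k : ℝ)
    (z : Fin n ⊕ Unit → ℝ) :
    z ⬝ᵥ (fromBlocks M (replicateCol Unit m) (replicateRow Unit m) (of fun _ _ : Unit => k) *ᵥ z) =
      (z ∘ Sum.inl) ⬝ᵥ (M *ᵥ (z ∘ Sum.inl)) + 2 * z (Sum.inr ()) * (m ⬝ᵥ (z ∘ Sum.inl)) +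
        k * z (Sum.inr ()) ^ 2 := by
  rw [fromBlocks_mulVec]
  conv_lhs => rw [← Sum.elim_comp_inl_inr z]
  rw [sumElim_dotProduct_sumElim]
  have h1 : replicateCol Unit m *ᵥ (z ∘ Sum.inr) = z (Sum.inr ()) • m := by
    ext i
    simp [mulVec, dotProduct, mul_comm]
  have h2 : (replicateRow Unit m *ᵥ (z ∘ Sum.inl)) = fun _ => m ⬝ᵥ (z ∘ Sum.inl) := by
    ext i
    simp [mulVec, dotProduct]
  simp only [Sum.elim_comp_inl, Sum.elim_comp_inr]
  rw [h1, h2]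
  simp only [dotProduct_add, dotProduct_smul, smul_eq_mul, dotProduct_comm _ m]
  simp [dotProduct, mulVec]
  ring

theorem isSymm_fromBlocks {n : ℕ} {M : Matrix (Fin n) (Fin n) ℝ} (hM : M.IsSymm) (m : Fin n → ℝ)
    (k : ℝ) :
    (fromBlocks M (replicateCol Unit m) (replicateRow Unit m) (of fun _ _ : Unit => k)).IsSymm :=
  IsSymm.fromBlocks hM (transpose_replicateCol m) rfl

section Quad

variable {n : ℕ} {M : Matrix (Fin n) (Fin n) ℝ}

theorem quad_add_smul (hM : M.IsSymm) (m : Fin n → ℝ) (k : ℝ) (x y : Fin n → ℝ) (t : ℝ) :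
    quad M m k (x + t • y) =
      quad M m k x + 2 * t * ((M *ᵥ x + m) ⬝ᵥ y) + t ^ 2 * (y ⬝ᵥ (M *ᵥ y)) := by
  have h := dotProduct_mulVec_swap hM x y
  simp only [quad, form_add_smul hM, dotProduct_add, dotProduct_smul, smul_eq_mul,
    add_dotProduct, h, dotProduct_comm (M *ᵥ x) y]
  ring

theorem quad_add (hM : M.IsSymm) (m : Fin n → ℝ) (k : ℝ) (x y : Fin n → ℝ) :
    quad M m k (x + y) =
      quad M m k x + 2 * ((M *ᵥ x + m) ⬝ᵥ y) + y ⬝ᵥ (M *ᵥ y) := by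
  simpa using quad_add_smul hM m k x y 1

theorem quad_add_mul (A B : Matrix (Fin n) (Fin n) ℝ) (a b : Fin n → ℝ) (c d μ : ℝ)
    (x : Fin n → ℝ) :
    quad (A + μ • B) (a + μ • b) (c + μ * d) x = quad A a c x + μ * quad B b d x := by
  simp only [quad, add_mulVec, smul_mulVec, dotProduct_add, dotProduct_smul, add_dotProduct,
    smul_dotProduct, smul_eq_mul]
  ring

theorem quad_neg (m : Fin n → ℝ) (k : ℝ) (x : Fin n → ℝ) :
    quad (-M) (-m) (-k) x = -quad M m k x := by
  simp only [quad, neg_mulVec, dotProduct_neg, neg_dotProduct]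
  ring

theorem quad_sub_const (m : Fin n → ℝ) (k s : ℝ) (x : Fin n → ℝ) :
    quad M m (k - s) x = quad M m k x - s := by
  simp only [quad]
  ring

theorem continuous_quad (M : Matrix (Fin n) (Fin n) ℝ) (m : Fin n → ℝ) (k : ℝ) :
    Continuous (quad M m k) := by
  unfold quad
  fun_prop

end Quad

/-! ### One-variable asymptotics. -/

theorem quadratic_leading_nonneg {α β γ : ℝ} (h : ∀ t : ℝ, 0 ≤ α * t ^ 2 + β * t + γ) :
    0 ≤ α := by
  by_contra hα
  push Not at hα
  -- Large enough for a negative leading term to outweigh the other two.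
  have h1 := h ((|β| + |γ| + 1) / -α + 1)
  set u := (|β| + |γ| + 1) / -α with hu
  have h2 : -α * u = |β| + |γ| + 1 := by
    have := hα.ne
    rw [hu]
    field_simp
  have hu0 : 0 ≤ u := by
    apply div_nonneg (by positivity)
    linarith
  have hb := le_abs_self β
  have hc := le_abs_self γ
  have hbu : β * (u + 1) ≤ |β| * (u + 1) := mul_le_mul_of_nonneg_right hb (by linarith)
  have hcu : 0 ≤ |γ| * u := by positivity
  nlinarith

theorem affine_slope_eq_zero {β γ : ℝ} (h : ∀ t : ℝ, 0 ≤ β * t + γ) : β = 0 := by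
  by_contra hβ
  have h1 := h (-(γ + 1) / β)
  have : β * (-(γ + 1) / β) = -(γ + 1) := by field_simp
  linarith

theorem leading_nonneg_of_punctured {G : ℝ → ℝ} (hG : Continuous G) (h : ∀ t ≠ 0, 0 ≤ G t) :
    0 ≤ G 0 := by
  have h1 : Filter.Tendsto G (nhdsWithin 0 {0}ᶜ) (nhds (G 0)) :=
    hG.continuousAt.tendsto.mono_left nhdsWithin_le_nhds
  exact ge_of_tendsto h1 (Filter.eventually_of_mem self_mem_nhdsWithin fun t ht => h t ht)

/-! ### Quadratic functions bounded below, or without zeros. -/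

section Bounded

variable {n : ℕ} {M : Matrix (Fin n) (Fin n) ℝ}

theorem form_nonneg_of_le_quad (hM : M.IsSymm) {m : Fin n → ℝ} {k s : ℝ}
    (h : ∀ x, s ≤ quad M m k x) (x : Fin n → ℝ) : 0 ≤ x ⬝ᵥ (M *ᵥ x) := by
  refine quadratic_leading_nonneg (β := 2 * ((M *ᵥ 0 + m) ⬝ᵥ x)) (γ := quad M m k 0 - s) fun t => ?_
  have h1 := h (0 + t • x)
  rw [quad_add_smul hM] at h1
  linarith

theorem dotProduct_eq_zero_of_le_quad {m : Fin n → ℝ} {k s : ℝ}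
    (h : ∀ x, s ≤ quad M m k x) {x : Fin n → ℝ} (hx : M *ᵥ x = 0) : m ⬝ᵥ x = 0 := by
  have h0 : 2 * (m ⬝ᵥ x) = 0 := by
    refine affine_slope_eq_zero (γ := k - s) fun t => ?_
    have h1 := h (t • x)
    simp only [quad, mulVec_smul, hx, smul_zero, dotProduct_zero, dotProduct_smul, smul_eq_mul]
      at h1
    linarith
  linarith

/-- `E = M M⁺` is an orthogonal projection, so the residual `m - E m` lies in the kernel of `M` and
is orthogonal to both `m` and `E m`, hence to itself. -/
theorem mulVec_pinv_mulVec_of_orthogonal_ker (hM : M.IsSymm) {m : Fin n → ℝ}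
    (h : ∀ x, M *ᵥ x = 0 → m ⬝ᵥ x = 0) : M *ᵥ (pinv M *ᵥ m) = m := by
  have hp := pinv_spec M
  set E := M * pinv M with hE
  have hEM : M * E = M := by
    have := congrArg transpose hp.mul_mul_left
    rwa [transpose_mul, hp.symm_left, hM.eq] at this
  have hEE : E * E = E := by
    rw [hE, Matrix.mul_assoc, ← Matrix.mul_assoc (pinv M), hp.mul_mul_right]
  set z := m - E *ᵥ m with hz
  have hMz : M *ᵥ z = 0 := by
    rw [hz, mulVec_sub, mulVec_mulVec, hEM, sub_self]
  have hEz : E *ᵥ z = 0 := by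
    rw [hz, mulVec_sub, mulVec_mulVec, hEE, sub_self]
  have hzz : z ⬝ᵥ z = 0 := by
    have h1 : (E *ᵥ m) ⬝ᵥ z = 0 := by
      rw [dotProduct_comm, dotProduct_mulVec_swap hp.symm_left, hEz, dotProduct_zero]
    nth_rewrite 1 [hz]
    rw [sub_dotProduct, h z hMz, h1, sub_zero]
  have hz0 : z = 0 := dotProduct_self_eq_zero.1 hzz
  rw [mulVec_mulVec]
  exact (sub_eq_zero.1 (hz ▸ hz0)).symm

theorem mulVec_pinv_mulVec_of_le_quad (hM : M.IsSymm) {m : Fin n → ℝ} {k s : ℝ}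
    (h : ∀ x, s ≤ quad M m k x) : M *ᵥ (pinv M *ᵥ m) = m :=
  mulVec_pinv_mulVec_of_orthogonal_ker hM fun _ => dotProduct_eq_zero_of_le_quad h

/-- The center is a critical point, so no linear term remains. -/
theorem quad_center_add (hM : M.IsSymm) {m : Fin n → ℝ} (hm : M *ᵥ (pinv M *ᵥ m) = m) (k : ℝ)
    (x : Fin n → ℝ) :
    quad M m k (-(pinv M *ᵥ m) + x) = quad M m k (-(pinv M *ᵥ m)) + x ⬝ᵥ (M *ᵥ x) := by
  rw [quad_add hM, mulVec_neg, hm]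
  simp

theorem quad_center {m : Fin n → ℝ} (hm : M *ᵥ (pinv M *ᵥ m) = m) (k : ℝ) :
    quad M m k (-(pinv M *ᵥ m)) = k - m ⬝ᵥ (pinv M *ᵥ m) := by
  rw [quad, mulVec_neg, hm]
  simp only [neg_dotProduct, dotProduct_neg, dotProduct_comm m]
  ring

theorem quad_pos_iff (hM : M.IsSymm) (m : Fin n → ℝ) (k : ℝ) :
    (∀ x, 0 < quad M m k x) ↔
      m ∈ LinearMap.range M.mulVecLin ∧ M.PosSemidef ∧ 0 < k - m ⬝ᵥ (pinv M *ᵥ m) := by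
  constructor
  · intro h
    have hm := mulVec_pinv_mulVec_of_le_quad hM fun x => (h x).le
    refine ⟨⟨_, hm⟩, (posSemidef_iff_form hM).2 (form_nonneg_of_le_quad hM fun x => (h x).le), ?_⟩
    rw [← quad_center hm]
    exact h _
  · rintro ⟨⟨u, rfl⟩, hpos, hk⟩ x
    have hm : M *ᵥ (pinv M *ᵥ (M.mulVecLin u)) = M.mulVecLin u := by
      simp only [mulVecLin_apply, mulVec_mulVec]
      rw [← Matrix.mul_assoc, (pinv_spec M).mul_mul_left]
    rw [← quad_center hm] at hk
    have h1 := quad_center_add hM hm k (x + pinv M *ᵥ (M.mulVecLin u))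
    have h2 : -(pinv M *ᵥ (M.mulVecLin u)) + (x + pinv M *ᵥ (M.mulVecLin u)) = x := by abel
    rw [h2] at h1
    rw [h1]
    exact add_pos_of_pos_of_nonneg hk ((posSemidef_iff_form hM).1 hpos _)

theorem pinv_neg (M : Matrix (Fin n) (Fin n) ℝ) : pinv (-M) = -pinv M := by
  refine (pinv_spec (-M)).unique ⟨?_, ?_, ?_, ?_⟩
  · simp [(pinv_spec M).mul_mul_left]
  · simp [(pinv_spec M).mul_mul_right]
  · simpa using (pinv_spec M).symm_left
  · simpa using (pinv_spec M).symm_right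

theorem quad_neg_iff (hM : M.IsSymm) (m : Fin n → ℝ) (k : ℝ) :
    (∀ x, quad M m k x < 0) ↔
      m ∈ LinearMap.range M.mulVecLin ∧ (-M).PosSemidef ∧ k - m ⬝ᵥ (pinv M *ᵥ m) < 0 := by
  have h := quad_pos_iff (M := -M) (by rw [IsSymm, transpose_neg, hM.eq]) (-m) (-k)
  have hr : -m ∈ LinearMap.range (-M).mulVecLin ↔ m ∈ LinearMap.range M.mulVecLin := by
    simp only [LinearMap.mem_range, mulVecLin_apply, neg_mulVec, neg_inj]
  have hv : -k - -m ⬝ᵥ (-(pinv M) *ᵥ -m) = -(k - m ⬝ᵥ (pinv M *ᵥ m)) := by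
    simp only [neg_mulVec, mulVec_neg, neg_neg, neg_dotProduct]
    ring
  rw [hr, pinv_neg, hv] at h
  simpa only [quad_neg, neg_pos] using h

theorem quad_ne_zero_iff (hM : M.IsSymm) (m : Fin n → ℝ) (k : ℝ) :
    (∀ x, quad M m k x ≠ 0) ↔
      m ∈ LinearMap.range M.mulVecLin ∧
        ((M.PosSemidef ∧ 0 < k - m ⬝ᵥ (pinv M *ᵥ m)) ∨
          ((-M).PosSemidef ∧ k - m ⬝ᵥ (pinv M *ᵥ m) < 0)) := by
  rw [and_or_left, ← quad_pos_iff hM, ← quad_neg_iff hM]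
  constructor
  · intro h
    by_contra hcon
    push Not at hcon
    obtain ⟨⟨x, hx⟩, y, hy⟩ := hcon
    obtain ⟨z, hz⟩ := mem_range_of_exists_le_of_exists_ge (continuous_quad M m k) ⟨x, hx⟩ ⟨y, hy⟩
    exact h z hz
  · rintro (h | h) x
    exacts [(h x).ne', (h x).ne]

end Bounded

/-! ### Dual feasibility and the S-lemma with equality. -/

section Dual

variable {n : ℕ} {A B : Matrix (Fin n) (Fin n) ℝ} {a b : Fin n → ℝ} {c d : ℝ}

theorem dualFeasible_iff (hA : A.IsSymm) (hB : B.IsSymm) (s μ : ℝ) :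
    DualFeasible A a c B b d s μ ↔ ∀ x, s ≤ quad A a c x + μ * quad B b d x := by
  have hM : (A + μ • B).IsSymm := hA.add (hB.smul μ)
  rw [DualFeasible, posSemidef_iff_form (isSymm_fromBlocks hM _ _)]
  simp only [form_fromBlocks, ← quad_add_mul]
  constructor
  · intro h x
    have := h (Sum.elim x fun _ => 1)
    simp only [Sum.elim_comp_inl, Sum.elim_inr] at this
    rw [quad]
    linarith
  · intro h z
    rcases eq_or_ne (z (Sum.inr ())) 0 with hz | hz
    · rw [hz]
      simpa using form_nonneg_of_le_quad hM h (z ∘ Sum.inl)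
    · set t := z (Sum.inr ())
      set x := z ∘ Sum.inl
      have h1 := h (t⁻¹ • x)
      simp only [quad, mulVec_smul, dotProduct_smul, smul_dotProduct, smul_eq_mul] at h1
      have h2 := mul_nonneg (sq_nonneg t) (sub_nonneg.2 h1)
      refine h2.trans_eq ?_
      field_simp
      ring

/-- The S-lemma with equality: if `h` changes sign and its quadratic part does not vanish, then
`f ≥ 0` on `{h = 0}` is certified by a multiplier. -/
theorem exists_multiplier (hA : A.IsSymm) (hB : B.IsSymm)
    (hneg : ∃ x, quad B b d x < 0) (hpos : ∃ x, 0 < quad B b d x) (hB0 : B ≠ 0)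
    (h : ∀ x, quad B b d x = 0 → 0 ≤ quad A a c x) :
    ∃ μ : ℝ, ∀ x, 0 ≤ quad A a c x + μ * quad B b d x := by
  -- These are the points at infinity `(x, 0)` of the homogenized problem.
  have hasym : ∀ x : Fin n → ℝ, x ⬝ᵥ (B *ᵥ x) = 0 → 0 ≤ x ⬝ᵥ (A *ᵥ x) := by
    intro x hx
    have line : ∀ y : Fin n → ℝ, (∀ t : ℝ, quad B b d (y + t • x) = 0) → 0 ≤ x ⬝ᵥ (A *ᵥ x) := by
      intro y hy
      refine quadratic_leading_nonneg (β := 2 * ((A *ᵥ y + a) ⬝ᵥ x)) (γ := quad A a c y) fun t => ?_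
      have h1 := h _ (hy t)
      rw [quad_add_smul hA] at h1
      linarith
    have hline : ∀ (y : Fin n → ℝ) (t : ℝ), quad B b d (y + t • x) =
        quad B b d y + 2 * t * ((B *ᵥ y + b) ⬝ᵥ x) := by
      intro y t
      rw [quad_add_smul hB, hx]
      ring
    -- Since `h` is affine along `x`, a nonzero slope gives a zero of `h` on the line through `y`;
    -- this is `f ≥ 0` there, with denominators cleared.
    have hslide : ∀ y : Fin n → ℝ, (B *ᵥ y + b) ⬝ᵥ x ≠ 0 →
        0 ≤ quad B b d y ^ 2 * (x ⬝ᵥ (A *ᵥ x))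
          - 4 * quad B b d y * ((B *ᵥ y + b) ⬝ᵥ x) * ((A *ᵥ y + a) ⬝ᵥ x)
          + 4 * ((B *ᵥ y + b) ⬝ᵥ x) ^ 2 * quad A a c y := by
      intro y hy
      have h1 := h (y + (-quad B b d y / (2 * ((B *ᵥ y + b) ⬝ᵥ x))) • x) (by
        rw [hline]
        field_simp
        ring)
      rw [quad_add_smul hA] at h1
      have h2 := mul_nonneg (sq_nonneg (2 * ((B *ᵥ y + b) ⬝ᵥ x))) h1
      refine h2.trans_eq ?_
      field_simp
      ring
    by_cases hBx : B *ᵥ x = 0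
    · have hBy : ∀ y : Fin n → ℝ, (B *ᵥ y + b) ⬝ᵥ x = b ⬝ᵥ x := by
        intro y
        rw [add_dotProduct, dotProduct_comm, dotProduct_mulVec_swap hB, hBx, dotProduct_zero,
          zero_add]
      by_cases hbx : b ⬝ᵥ x = 0
      · obtain ⟨y, hy⟩ := mem_range_of_exists_le_of_exists_ge (continuous_quad B b d)
          (hneg.imp fun _ h => h.le) (hpos.imp fun _ h => h.le)
        refine line y fun t => ?_
        rw [hline, hBy, hbx, hy]
        ring
      -- Here `h` has constant nonzero slope along `x`. Sliding from `t⁻¹ y`, multiplying by `t ^ 4`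
      -- and letting `t → 0` leaves `(yᵀBy)² xᵀAx ≥ 0`.
      · obtain ⟨y, hy⟩ : ∃ y : Fin n → ℝ, y ⬝ᵥ (B *ᵥ y) ≠ 0 := by
          by_contra hcon
          push Not at hcon
          apply hB0
          have h1 : ∀ y z : Fin n → ℝ, y ⬝ᵥ (B *ᵥ z) = 0 := by
            intro y z
            have h2 := hcon (y + (1 : ℝ) • z)
            rw [form_add_smul hB, hcon, hcon] at h2
            linarith
          refine Matrix.ext fun i j => ?_
          have h2 := h1 (Pi.single i 1) (Pi.single j 1)
          simpa using h2
        have h3 : 0 ≤ (y ⬝ᵥ (B *ᵥ y)) ^ 2 * (x ⬝ᵥ (A *ᵥ x)) := by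
          set β := b ⬝ᵥ x
          set P := y ⬝ᵥ (B *ᵥ y)
          set R := (A *ᵥ y) ⬝ᵥ x
          have h4 := leading_nonneg_of_punctured
            (G := fun t : ℝ => (P + 2 * t * (b ⬝ᵥ y) + t ^ 2 * d) ^ 2 * (x ⬝ᵥ (A *ᵥ x))
              - 4 * (P + 2 * t * (b ⬝ᵥ y) + t ^ 2 * d) * β * (t * R + t ^ 2 * (a ⬝ᵥ x))
              + 4 * β ^ 2 * t ^ 2 * (y ⬝ᵥ (A *ᵥ y) + 2 * t * (a ⬝ᵥ y) + t ^ 2 * c))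
            (by fun_prop) (fun t ht => by
              have h5 := hslide (t⁻¹ • y) (by rwa [hBy])
              rw [hBy] at h5
              simp only [quad, mulVec_smul, dotProduct_smul, smul_dotProduct, smul_eq_mul,
                add_dotProduct] at h5
              have h6 := mul_nonneg (sq_nonneg (t ^ 2)) h5
              refine h6.trans_eq ?_
              field_simp
              ring)
          simpa using h4
        exact nonneg_of_mul_nonneg_right h3 (by positivity)
    · set y := B *ᵥ x with hy
      have hyy : 0 < y ⬝ᵥ y := by
        have : 0 ≤ y ⬝ᵥ y := Finset.sum_nonneg fun i _ => mul_self_nonneg (y i)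
        exact lt_of_le_of_ne this fun h0 => hBx (dotProduct_self_eq_zero.1 h0.symm)
      have hslope : ∀ u : Fin n → ℝ, (B *ᵥ u + b) ⬝ᵥ x = u ⬝ᵥ y + b ⬝ᵥ x := by
        intro u
        rw [add_dotProduct, dotProduct_comm, dotProduct_mulVec_swap hB]
      -- At `σ y` the slope of `h` along `x` vanishes. Either the whole line is feasible, or sliding
      -- from nearby points sends the zeros to infinity and the limit gives `h(σ y)² xᵀAx ≥ 0`.
      set σ := -(b ⬝ᵥ x) / (y ⬝ᵥ y) with hσ
      have hσy : (σ • y) ⬝ᵥ y + b ⬝ᵥ x = 0 := by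
        rw [smul_dotProduct, smul_eq_mul, hσ]
        field_simp
        ring
      have hshift : ∀ t : ℝ, (σ • y + t • y) ⬝ᵥ y + b ⬝ᵥ x = t * (y ⬝ᵥ y) := by
        intro t
        rw [add_dotProduct, smul_dotProduct t, smul_eq_mul]
        linarith
      by_cases hK : quad B b d (σ • y) = 0
      · refine line (σ • y) fun t => ?_
        rw [hline, hslope, hσy, hK]
        ring
      · have hcont : Continuous fun t : ℝ => σ • y + t • y := by fun_prop
        have hA' := (continuous_quad A a c).comp hcont
        have hB' := (continuous_quad B b d).comp hcont
        have h4 := leading_nonneg_of_punctured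
          (G := fun t : ℝ => quad B b d (σ • y + t • y) ^ 2 * (x ⬝ᵥ (A *ᵥ x))
            - 4 * quad B b d (σ • y + t • y) * (t * (y ⬝ᵥ y)) *
              ((A *ᵥ (σ • y + t • y) + a) ⬝ᵥ x)
            + 4 * (t * (y ⬝ᵥ y)) ^ 2 * quad A a c (σ • y + t • y))
          (by
            simp only [Function.comp_def] at hA' hB'
            fun_prop)
          (fun t ht => by
            have h5 := hslide (σ • y + t • y) (by
              rw [hslope, hshift]
              positivity)
            rw [hslope, hshift] at h5
            exact h5)
        have h7 : 0 ≤ quad B b d (σ • y) ^ 2 * (x ⬝ᵥ (A *ᵥ x)) := by simpa using h4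
        exact nonneg_of_mul_nonneg_right h7 (by positivity)
  have lift : ∀ (M : Matrix (Fin n) (Fin n) ℝ) (m : Fin n → ℝ) (k : ℝ) (x : Fin n → ℝ),
      (Sum.elim x fun _ : Unit => (1 : ℝ)) ⬝ᵥ (fromBlocks M (replicateCol Unit m)
        (replicateRow Unit m) (of fun _ _ : Unit => k) *ᵥ (Sum.elim x fun _ : Unit => (1 : ℝ))) =
      quad M m k x := by
    intro M m k x
    rw [form_fromBlocks, quad]
    simp
  obtain ⟨μ, hμ⟩ := exists_multiplier_form (isSymm_fromBlocks hA a c) (isSymm_fromBlocks hB b d)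
    (by
      obtain ⟨p, hp⟩ := hpos
      exact ⟨_, (lift B b d p).symm ▸ hp⟩)
    (by
      obtain ⟨q, hq⟩ := hneg
      exact ⟨_, (lift B b d q).symm ▸ hq⟩)
    (by
      intro z hz
      rw [form_fromBlocks] at hz ⊢
      rcases eq_or_ne (z (Sum.inr ())) 0 with h0 | h0
      · rw [h0] at hz ⊢
        simpa using hasym _ (by simpa using hz)
      · set t := z (Sum.inr ())
        set x := z ∘ Sum.inl
        have scale : ∀ (M : Matrix (Fin n) (Fin n) ℝ) (m : Fin n → ℝ) (k : ℝ),
            x ⬝ᵥ (M *ᵥ x) + 2 * t * (m ⬝ᵥ x) + k * t ^ 2 = t ^ 2 * quad M m k (t⁻¹ • x) := by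
          intro M m k
          simp only [quad, mulVec_smul, dotProduct_smul, smul_dotProduct, smul_eq_mul]
          field_simp
        rw [scale] at hz ⊢
        have ht : t ^ 2 ≠ 0 := pow_ne_zero 2 h0
        exact mul_nonneg (sq_nonneg t) (h _ ((mul_eq_zero.1 hz).resolve_left ht)))
  refine ⟨μ, fun x => ?_⟩
  have h1 := hμ (Sum.elim x fun _ : Unit => (1 : ℝ))
  rwa [lift, lift] at h1

end Dual

/-! ### Attainment from two multipliers. -/

section Attainment

variable {n : ℕ} {A B : Matrix (Fin n) (Fin n) ℝ} {a b : Fin n → ℝ} {c d : ℝ}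

theorem exists_transpose_mul_self {M : Matrix (Fin n) (Fin n) ℝ} (hM : M.PosSemidef) :
    ∃ C : Matrix (Fin n) (Fin n) ℝ, M = Cᵀ * C := by
  open scoped MatrixOrder in
  obtain ⟨C, hC⟩ := CStarAlgebra.nonneg_iff_eq_star_mul_self.mp hM.nonneg
  exact ⟨C, by rwa [star_eq_conjTranspose, conjTranspose_eq_transpose_of_trivial] at hC⟩

theorem isCompact_dotProduct_self_le (R : ℝ) : IsCompact {u : Fin n → ℝ | u ⬝ᵥ u ≤ R} := by
  refine IsCompact.of_isClosed_subset
    (isCompact_Icc (a := fun _ : Fin n => -(R + 1)) (b := fun _ => R + 1))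
    (isClosed_le (by fun_prop) continuous_const) fun u hu => ?_
  have hi : ∀ i, u i * u i ≤ R := fun i =>
    (Finset.single_le_sum (f := fun j => u j * u j) (fun j _ => mul_self_nonneg (u j))
      (Finset.mem_univ i)).trans hu
  constructor <;> intro i <;> nlinarith [hi i, sq_nonneg (u i - 1), sq_nonneg (u i + 1)]

/-- If two different multipliers make `f + μ h` bounded below, then `f` attains its minimum on
`{h = 0}`: modulo the directions along which both functions are constant, `f + μ h` is coercive for
an intermediate `μ`. -/
theorem exists_minimizer_of_two_multipliers (hA : A.IsSymm) (hB : B.IsSymm) {μ₁ μ₂ s₁ s₂ : ℝ}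
    (hμ : μ₁ ≠ μ₂) (h₁ : ∀ x, s₁ ≤ quad A a c x + μ₁ * quad B b d x)
    (h₂ : ∀ x, s₂ ≤ quad A a c x + μ₂ * quad B b d x) (hne : ∃ x, quad B b d x = 0) :
    ∃ x, quad B b d x = 0 ∧ ∀ y, quad B b d y = 0 → quad A a c x ≤ quad A a c y := by
  obtain ⟨x₀, hx₀⟩ := hne
  set μ := (μ₁ + μ₂) / 2 with hμdef
  have h₀ : ∀ x, (s₁ + s₂) / 2 ≤ quad A a c x + μ * quad B b d x := by
    intro x
    have e : μ * quad B b d x = (μ₁ * quad B b d x + μ₂ * quad B b d x) / 2 := by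
      rw [hμdef]
      ring
    linarith [h₁ x, h₂ x]
  simp only [← quad_add_mul] at h₁ h₂ h₀
  have symm : ∀ ν : ℝ, (A + ν • B).IsSymm := fun ν => hA.add (hB.smul ν)
  set M := A + μ • B with hM
  set m := a + μ • b with hm
  have hpos := form_nonneg_of_le_quad (symm μ) h₀
  obtain ⟨C, hC⟩ := exists_transpose_mul_self ((posSemidef_iff_form (symm μ)).2 hpos)
  have hcenter := mulVec_pinv_mulVec_of_le_quad (symm μ) h₀
  set x₁ := -(pinv M *ᵥ m)
  -- The endpoint forms are nonnegative and sum to twice the midpoint form, so `z` is null for both;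
  -- `μ₁ ≠ μ₂` then separates `A` from `B` and `a` from `b`.
  have hker : ∀ z, M *ᵥ z = 0 → A *ᵥ z = 0 ∧ B *ᵥ z = 0 ∧ a ⬝ᵥ z = 0 ∧ b ⬝ᵥ z = 0 := by
    intro z hz
    have e : ∀ ν : ℝ, z ⬝ᵥ ((A + ν • B) *ᵥ z) = z ⬝ᵥ (A *ᵥ z) + ν * (z ⬝ᵥ (B *ᵥ z)) := by
      intro ν
      simp [add_mulVec, smul_mulVec]
    have p₁ := form_nonneg_of_le_quad (symm μ₁) h₁ z
    have p₂ := form_nonneg_of_le_quad (symm μ₂) h₂ z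
    have p₀ : z ⬝ᵥ (M *ᵥ z) = 0 := by rw [hz, dotProduct_zero]
    have hsum : z ⬝ᵥ ((A + μ₁ • B) *ᵥ z) + z ⬝ᵥ ((A + μ₂ • B) *ᵥ z) = 2 * (z ⬝ᵥ (M *ᵥ z)) := by
      rw [hM, e, e, e, hμdef]
      ring
    have z₁ := posSemidef_mulVec_eq_zero (symm μ₁) (form_nonneg_of_le_quad (symm μ₁) h₁)
      (x := z) (by linarith)
    have z₂ := posSemidef_mulVec_eq_zero (symm μ₂) (form_nonneg_of_le_quad (symm μ₂) h₂)
      (x := z) (by linarith)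
    have l₁ := dotProduct_eq_zero_of_le_quad h₁ z₁
    have l₂ := dotProduct_eq_zero_of_le_quad h₂ z₂
    rw [add_mulVec, smul_mulVec] at z₁ z₂
    rw [add_dotProduct, smul_dotProduct, smul_eq_mul] at l₁ l₂
    have hB0 : B *ᵥ z = 0 := by
      have : (μ₁ - μ₂) • (B *ᵥ z) = 0 := by
        rw [sub_smul, ← add_sub_add_left_eq_sub _ _ (A *ᵥ z), z₁, z₂, sub_zero]
      exact (smul_eq_zero.1 this).resolve_left (sub_ne_zero.2 hμ)
    have hb0 : b ⬝ᵥ z = 0 := by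
      have : (μ₁ - μ₂) * (b ⬝ᵥ z) = 0 := by linarith
      exact (mul_eq_zero.1 this).resolve_left (sub_ne_zero.2 hμ)
    refine ⟨?_, hB0, ?_, hb0⟩
    · simpa [hB0] using z₁
    · simpa [hb0] using l₁
  have invariant : ∀ z, M *ᵥ z = 0 → ∀ x, quad A a c (x + z) = quad A a c x ∧
      quad B b d (x + z) = quad B b d x := by
    intro z hz x
    obtain ⟨k1, k2, k3, k4⟩ := hker z hz
    rw [quad_add hA, quad_add hB, k1, k2, add_dotProduct, add_dotProduct, k3, k4, dotProduct_comm,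
      dotProduct_mulVec_swap hA, k1, dotProduct_comm (B *ᵥ x), dotProduct_mulVec_swap hB, k2]
    simp
  -- `T C = M⁺ M`, so `x - T C x` lies in `ker M` and both functions depend only on `C (x - x₁)`.
  set T := pinv M * Cᵀ
  have hproj : ∀ x, M *ᵥ (x - T *ᵥ (C *ᵥ x)) = 0 := by
    intro x
    have : M * (T * C) = M := by
      rw [Matrix.mul_assoc, ← hC, ← Matrix.mul_assoc, (pinv_spec M).mul_mul_left]
    rw [mulVec_sub, mulVec_mulVec, mulVec_mulVec, Matrix.mul_assoc, this, sub_self]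
  have hparam : ∀ x, quad A a c x = quad A a c (x₁ + T *ᵥ (C *ᵥ (x - x₁))) ∧
      quad B b d x = quad B b d (x₁ + T *ᵥ (C *ᵥ (x - x₁))) := by
    intro x
    have h := invariant _ (hproj (x - x₁)) (x₁ + T *ᵥ (C *ᵥ (x - x₁)))
    have e : x₁ + T *ᵥ (C *ᵥ (x - x₁)) + (x - x₁ - T *ᵥ (C *ᵥ (x - x₁))) = x := by abel
    rwa [e] at h
  have hnorm : ∀ x, (C *ᵥ (x - x₁)) ⬝ᵥ (C *ᵥ (x - x₁)) =
      quad M m (c + μ * d) x - quad M m (c + μ * d) x₁ := by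
    intro x
    have h := quad_center_add (symm μ) hcenter (c + μ * d) (x - x₁)
    rw [show -(pinv (A + μ • B) *ᵥ (a + μ • b)) + (x - x₁) = x from add_sub_cancel x₁ x] at h
    have e : (x - x₁) ⬝ᵥ (M *ᵥ (x - x₁)) = (C *ᵥ (x - x₁)) ⬝ᵥ (C *ᵥ (x - x₁)) := by
      rw [show M = Cᵀ * C from hC, ← mulVec_mulVec, dotProduct_mulVec, vecMul_transpose]
    rw [h, e]
    exact (add_sub_cancel_left _ _).symm
  set R := quad A a c x₀ - quad M m (c + μ * d) x₁
  have hlevel : ∀ x, quad B b d x = 0 → quad A a c x ≤ quad A a c x₀ →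
      (C *ᵥ (x - x₁)) ⬝ᵥ (C *ᵥ (x - x₁)) ≤ R := by
    intro x hx hle
    rw [hnorm, quad_add_mul, hx]
    simp only [R]
    linarith
  have hcont : Continuous fun u : Fin n → ℝ => x₁ + T *ᵥ u := by fun_prop
  -- Vectors `u` outside the range of `C` do no harm: `x₁ + T u` is feasible for every `u` in this
  -- set.
  have hK : IsCompact ({u : Fin n → ℝ | u ⬝ᵥ u ≤ R} ∩ {u | quad B b d (x₁ + T *ᵥ u) = 0}) :=
    (isCompact_dotProduct_self_le R).inter_right
      (isClosed_eq ((continuous_quad B b d).comp hcont) continuous_const)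
  have hmem : ∀ x, quad B b d x = 0 → quad A a c x ≤ quad A a c x₀ →
      C *ᵥ (x - x₁) ∈ {u : Fin n → ℝ | u ⬝ᵥ u ≤ R} ∩ {u | quad B b d (x₁ + T *ᵥ u) = 0} :=
    fun x hx hle => ⟨hlevel x hx hle, (hparam x).2.symm.trans hx⟩
  obtain ⟨u, hu, hmin⟩ := hK.exists_isMinOn ⟨_, hmem x₀ hx₀ le_rfl⟩
    ((continuous_quad A a c).comp hcont).continuousOn
  have hmin' : ∀ y, quad B b d y = 0 → quad A a c y ≤ quad A a c x₀ →
      quad A a c (x₁ + T *ᵥ u) ≤ quad A a c y := by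
    intro y hy hle
    rw [(hparam y).1]
    exact hmin (hmem y hy hle)
  refine ⟨x₁ + T *ᵥ u, hu.2, fun y hy => ?_⟩
  rcases le_total (quad A a c y) (quad A a c x₀) with hle | hle
  · exact hmin' y hy hle
  · exact (hmin' x₀ hx₀ le_rfl).trans hle

end Attainment

/-! ### Finite optimal value and restriction to the null space. -/

theorem exists_real_primalValue {n : ℕ} {f h : (Fin n → ℝ) → ℝ} (hbdd : ⊥ < primalValue f h)
    (hne : ∃ x, h x = 0) :
    ∃ v : ℝ, primalValue f h = v ∧ (∀ x, h x = 0 → v ≤ f x) ∧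
      ∀ s : ℝ, (∀ x, h x = 0 → s ≤ f x) → s ≤ v := by
  obtain ⟨x₀, hx₀⟩ := hne
  have hle : ∀ x, h x = 0 → primalValue f h ≤ f x := fun x hx =>
    iInf_le (fun x : {x : Fin n → ℝ // h x = 0} => (f x.1 : EReal)) ⟨x, hx⟩
  have htop : primalValue f h ≠ ⊤ := ((hle x₀ hx₀).trans_lt (EReal.coe_lt_top _)).ne
  have hv := EReal.coe_toReal htop hbdd.ne'
  refine ⟨(primalValue f h).toReal, hv.symm, fun x hx => ?_, fun s hs => ?_⟩
  · rw [← EReal.coe_le_coe_iff, hv]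
    exact hle x hx
  · rw [← EReal.coe_le_coe_iff, hv]
    exact le_iInf fun x => EReal.coe_le_coe_iff.2 (hs x.1 x.2)

theorem IsNullBasis.mulVec_eq_zero_iff {n r : ℕ} {M : Matrix (Fin n) (Fin n) ℝ}
    {V : Matrix (Fin n) (Fin r) ℝ} (hV : IsNullBasis M V) (z : Fin n → ℝ) :
    M *ᵥ z = 0 ↔ ∃ w, V *ᵥ w = z := by
  have h : z ∈ LinearMap.ker M.mulVecLin ↔ z ∈ LinearMap.range V.mulVecLin := by
    rw [range_mulVecLin, hV.2]
  simpa using h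

theorem quad_add_mulVec {n r : ℕ} {B : Matrix (Fin n) (Fin n) ℝ} (hB : B.IsSymm) (b : Fin n → ℝ)
    (d : ℝ) (V : Matrix (Fin n) (Fin r) ℝ) (y : Fin n → ℝ) (w : Fin r → ℝ) :
    quad B b d (y + V *ᵥ w) =
      quad (Vᵀ * B * V) (Vᵀ *ᵥ (B *ᵥ y + b)) (quad B b d y) w := by
  have h1 : (V *ᵥ w) ⬝ᵥ (B *ᵥ (V *ᵥ w)) = w ⬝ᵥ ((Vᵀ * B * V) *ᵥ w) := by
    rw [Matrix.mul_assoc, ← mulVec_mulVec, ← mulVec_mulVec, dotProduct_mulVec w, vecMul_transpose]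
  have h2 : (Vᵀ *ᵥ (B *ᵥ y + b)) ⬝ᵥ w = (B *ᵥ y + b) ⬝ᵥ (V *ᵥ w) := by
    rw [dotProduct_comm, dotProduct_mulVec, vecMul_transpose, dotProduct_comm]
  rw [quad_add hB, h1, ← h2]
  simp only [quad]
  ring

end QuadEq

/-! ### Strong duality and the criterion for nonattainment. -/

theorem theorem5 {n : ℕ} (A B : Matrix (Fin n) (Fin n) ℝ) (a b : Fin n → ℝ) (c d : ℝ)
    (hA : A.IsSymm) (hB : B.IsSymm)
    (hslater : ∃ x' x'' : Fin n → ℝ, QuadEq.quad B b d x' < 0 ∧ 0 < QuadEq.quad B b d x'')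
    (hB0 : B ≠ 0)
    (hbdd : ⊥ < QuadEq.primalValue (QuadEq.quad A a c) (QuadEq.quad B b d)) :
    (∃ s μ : ℝ, QuadEq.DualOptimal A a c B b d s μ) ∧
    ∀ (r : ℝ → ℕ) (V : ∀ μ : ℝ, Matrix (Fin n) (Fin (r μ)) ℝ),
      (∀ μ : ℝ, QuadEq.IsNullBasis (A + μ • B) (V μ)) →
      (¬ QuadEq.PrimalAttained (QuadEq.quad A a c) (QuadEq.quad B b d) ↔
        ∃ μ : ℝ, {ν : ℝ | ∃ s : ℝ, QuadEq.DualFeasible A a c B b d s ν} = {μ} ∧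
          (V μ)ᵀ *ᵥ (B *ᵥ QuadEq.basePoint A a B b μ + b) ∈
            LinearMap.range ((V μ)ᵀ * B * V μ).mulVecLin ∧
          ((((V μ)ᵀ * B * V μ).PosSemidef ∧
              0 < QuadEq.reducedValue B b d (V μ) (QuadEq.basePoint A a B b μ)) ∨
            ((-((V μ)ᵀ * B * V μ)).PosSemidef ∧
              QuadEq.reducedValue B b d (V μ) (QuadEq.basePoint A a B b μ) < 0))) := by
  open QuadEq in
  obtain ⟨x', x'', hx', hx''⟩ := hslater
  have hne : ∃ x, quad B b d x = 0 :=
    mem_range_of_exists_le_of_exists_ge (continuous_quad B b d) ⟨x', hx'.le⟩ ⟨x'', hx''.le⟩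
  obtain ⟨v, hv, hvle, hvmax⟩ := exists_real_primalValue hbdd hne
  have hattained : PrimalAttained (quad A a c) (quad B b d) ↔
      ∃ x, quad B b d x = 0 ∧ quad A a c x = v := by
    simp only [PrimalAttained, hv, EReal.coe_eq_coe_iff]
  obtain ⟨μ₀, hμ₀⟩ : ∃ μ : ℝ, ∀ x, v ≤ quad A a c x + μ * quad B b d x := by
    obtain ⟨μ, hμ⟩ := exists_multiplier (A := A) (a := a) (c := c - v) hA hB ⟨x', hx'⟩ ⟨x'', hx''⟩
      hB0 fun x hx => by
        rw [quad_sub_const]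
        linarith [hvle x hx]
    refine ⟨μ, fun x => ?_⟩
    have := hμ x
    rw [quad_sub_const] at this
    linarith
  have weak : ∀ s ν : ℝ, (∀ x, s ≤ quad A a c x + ν * quad B b d x) → s ≤ v := by
    intro s ν h
    refine hvmax s fun x hx => ?_
    simpa [hx] using h x
  refine ⟨⟨v, μ₀, (dualFeasible_iff hA hB v μ₀).2 hμ₀, fun s' μ' h' =>
    weak s' μ' ((dualFeasible_iff hA hB s' μ').1 h')⟩, fun r V hV => ?_⟩
  simp only [dualFeasible_iff hA hB]
  -- Valid for any multiplier certifying `v`; uniqueness plays no role here.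
  have unique_case : ∀ μ : ℝ, (∀ x, v ≤ quad A a c x + μ * quad B b d x) →
      (¬ PrimalAttained (quad A a c) (quad B b d) ↔
        (V μ)ᵀ *ᵥ (B *ᵥ basePoint A a B b μ + b) ∈
            LinearMap.range ((V μ)ᵀ * B * V μ).mulVecLin ∧
          ((((V μ)ᵀ * B * V μ).PosSemidef ∧
              0 < reducedValue B b d (V μ) (basePoint A a B b μ)) ∨
            ((-((V μ)ᵀ * B * V μ)).PosSemidef ∧
              reducedValue B b d (V μ) (basePoint A a B b μ) < 0))) := by
    intro μ hμ
    have hM : (A + μ • B).IsSymm := hA.add (hB.smul μ)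
    have hW : ((V μ)ᵀ * B * V μ).IsSymm := by
      rw [IsSymm, transpose_mul, transpose_mul, transpose_transpose, hB.eq, Matrix.mul_assoc]
    have hμ' : ∀ x, v ≤ quad (A + μ • B) (a + μ • b) (c + μ * d) x := fun x =>
      (hμ x).trans_eq (quad_add_mul ..).symm
    have hpos := form_nonneg_of_le_quad hM hμ'
    have hsplit := quad_center_add hM (mulVec_pinv_mulVec_of_le_quad hM hμ') (c + μ * d)
    -- The global minimum of `f + μ h` is itself a dual value, so weak duality bounds it by `v`.
    have hmin : quad (A + μ • B) (a + μ • b) (c + μ * d) (basePoint A a B b μ) = v := by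
      refine le_antisymm (weak _ μ fun x => ?_) (hμ' _)
      have h := hsplit (x - basePoint A a B b μ)
      rw [show -(pinv (A + μ • B) *ᵥ (a + μ • b)) + (x - basePoint A a B b μ) = x from
        add_sub_cancel _ x, quad_add_mul _ _ _ _ _ _ _ x] at h
      rw [h]
      exact le_add_of_nonneg_right (hpos _)
    simp only [reducedValue]
    rw [hattained, ← quad_ne_zero_iff hW]
    simp only [← quad_add_mulVec hB]
    rw [not_iff_comm]
    push Not
    constructor
    · rintro ⟨w, hw⟩
      refine ⟨_, hw, ?_⟩
      have hz := ((hV μ).mulVec_eq_zero_iff (V μ *ᵥ w)).2 ⟨w, rfl⟩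
      have h := hsplit (V μ *ᵥ w)
      rw [hz, dotProduct_zero, add_zero] at h
      have h2 := quad_add_mul A B a b c d μ (basePoint A a B b μ + V μ *ᵥ w)
      rw [hw, mul_zero, add_zero] at h2
      rw [← h2, ← hmin]
      exact h
    · rintro ⟨x, hx, hfx⟩
      have h := hsplit (x - basePoint A a B b μ)
      rw [show -(pinv (A + μ • B) *ᵥ (a + μ • b)) + (x - basePoint A a B b μ) = x from
        add_sub_cancel _ x, quad_add_mul _ _ _ _ _ _ _ x, hx, hfx] at h
      change _ = quad (A + μ • B) (a + μ • b) (c + μ * d) (basePoint A a B b μ) + _ at h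
      rw [hmin] at h
      -- A primal solution also minimizes `f + μ h`, so its offset from `y₀` is null for the
      -- semidefinite form.
      obtain ⟨w, hw⟩ := ((hV μ).mulVec_eq_zero_iff _).1
        (posSemidef_mulVec_eq_zero hM hpos (x := x - basePoint A a B b μ) (by linarith))
      exact ⟨w, by rw [hw, add_sub_cancel, hx]⟩
  constructor
  · intro hnot
    refine ⟨μ₀, ?_, (unique_case μ₀ hμ₀).1 hnot⟩
    refine Set.eq_singleton_iff_unique_mem.2 ⟨⟨v, hμ₀⟩, ?_⟩
    rintro ν ⟨s, hs⟩
    by_contra hνμ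
    obtain ⟨x, hx, hxmin⟩ := exists_minimizer_of_two_multipliers hA hB hνμ hs hμ₀ hne
    exact hnot (hattained.2 ⟨x, hx, le_antisymm (hvmax _ hxmin) (hvle x hx)⟩)
  · rintro ⟨μ, hμ, hcond⟩
    -- The singleton condition serves only to ensure that `μ` certifies `v`.
    have hμμ₀ : μ₀ = μ := by
      have : μ₀ ∈ ({μ} : Set ℝ) := hμ ▸ ⟨v, hμ₀⟩
      exact this
    exact (unique_case μ (hμμ₀ ▸ hμ₀)).2 hcond
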